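/- Let $\mathcal M\subseteq\mathbb R^d$ be a closed subset that is a topologically embedded $n$-dimensional submanifold without boundary. Let $\mathcal R>0$ be a real number not exceeding the reach of $\mathcal M$, that is, the distance between $\mathcal M$ and its medial axis (the set of points of $\mathbb R^d$ that do not have a unique closest point on $\mathcal M$; the reach is $\infty$ if the medial axis is empty). Write $B(\rho)$ for the closed ball of radius $\rho$ centred at $0$ and $\oplus$ for the Minkowski sum. Let $P\subseteq\mathbb R^d$ be a set and $0\le\delta\le\varepsilon<\mathcal R$ be real numbers with $$\mathcal M\subseteq P\oplus B(\varepsilon),\qquad P\subseteq \mathcal M\oplus B(\delta),\qquad (\mathcal R-\delta)^2-\varepsilon^2\ \ge\ (4\sqrt2-5)\,\mathcal R^2 .$$ Put $$\Delta=\tfrac{1}{\mathcal R^2}\bigl(\varepsilon^2-(\mathcal R-\delta)^2\bigr)^2-10\bigl(\varepsilon^2-(\mathcal R-\delta)^2\bigr)-7\mathcal R^2,$$ $$\alpha_{\min}=\tfrac14\Bigl(\tfrac{(\mathcal R-\delta)^2+\mathcal R^2-\varepsilon^2}{\mathcal R}-\sqrt\Delta\Bigr),\qquad \alpha_{\max}=\tfrac14\Bigl(\tfrac{(\mathcal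 R-\delta)^2+\mathcal R^2-\varepsilon^2}{\mathcal R}+\sqrt\Delta\Bigr).$$ Then there is a radius $r>0$ such that the union of balls $P\oplus B(r)$ deformation-retracts onto $\mathcal M$ along the closest-point projection $\pi_{\mathcal M}$: we have $\mathcal M\subseteq P\oplus B(r)$, every point of $P\oplus B(r)$ has a unique closest point on $\mathcal M$, and $(t,x)\mapsto(1-t)x+t\,\pi_{\mathcal M}(x)$ is a well-defined continuous map $[0,1]\times(P\oplus B(r))\to P\oplus B(r)$ that is the identity at $t=0$, has values in $\mathcal M$ at $t=1$, and fixes every point of $\mathcal M$ at all times. More precisely, this holds for every $r$ with $0<r<\mathcal R$ and $$\Bigl(1+\tfrac{\alpha_{\min}}{\mathcal R}\Bigr)\varepsilon^2+\alpha_{\min}^2+\tfrac{\alpha_{\min}}{\mathcal R}\bigl(\mathcal R^2-(\mathcal R-\delta)^2\bigr)\ \le\ r^2\ \le\ (\mathcal R-\delta)^2-(\mathcal R-\alpha_{\max})^2,$$ and such an $r$ exists. -/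

import Mathlib

open scoped Pointwise

/-- `y` is a closest point of `S` to `x`: it lies in `S` and realizes the distance from `x` to `S`. -/
def IsClosestPoint {E : Type*} [PseudoMetricSpace E] (S : Set E) (x y : E) : Prop :=
  y ∈ S ∧ dist x y = Metric.infDist x S

/-- The medial axis of `S`: the points of the ambient space without a unique closest point
on `S`. -/
def medialAxis {E : Type*} [PseudoMetricSpace E] (S : Set E) : Set E :=
  {x | ¬ ∃! y, IsClosestPoint S x y}

/-- The reach of `S`: the distance between the medial axis of `S` and `S`
(infinite if the medial axis is empty). -/
noncomputable def reach {E : Type*} [PseudoMetricSpace E] (S : Set E) : ENNReal :=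
  ⨅ x ∈ medialAxis S, Metric.infEDist x S

open Classical in
/-- The closest-point projection onto `S`. It is meaningful at points that have a unique closest
point on `S`; at points without any closest point its value is the point itself. -/
noncomputable def closestPointProj {E : Type*} [PseudoMetricSpace E] (S : Set E) (x : E) : E :=
  if h : ∃ y, IsClosestPoint S x y then h.choose else x

/-- The subset `M` of a topological space is an `n`-dimensional (topologically embedded)
submanifold without boundary: with the subspace topology, it is covered by open sets
homeomorphic to open subsets of `ℝⁿ`. -/
def IsSubmanifold {E : Type*} [TopologicalSpace E] (n : ℕ) (M : Set E) : Prop :=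
  Nonempty (ChartedSpace (EuclideanSpace ℝ (Fin n)) M)

/-- `H : [0,1] × X → X` is a deformation retraction (in the strong sense) of `X` onto `A ⊆ X`:
it is continuous, starts at the identity, ends in `A`, and fixes `A` at all times. -/
structure IsDeformationRetraction {E : Type*} [TopologicalSpace E]
    (X A : Set E) (H : ℝ × E → E) : Prop where
  subset : A ⊆ X
  continuousOn : ContinuousOn H (Set.Icc (0 : ℝ) 1 ×ˢ X)
  mapsTo : ∀ t ∈ Set.Icc (0 : ℝ) 1, ∀ x ∈ X, H (t, x) ∈ X
  map_zero : ∀ x ∈ X, H (0, x) = x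
  map_one : ∀ x ∈ X, H (1, x) ∈ A
  fixes : ∀ t ∈ Set.Icc (0 : ℝ) 1, ∀ a ∈ A, H (t, a) = a

/-- `X` deformation-retracts onto `S` along the closest-point projection: every point of `X` has a
unique closest point on `S`, and moving each point of `X` along the straight segment to its closest
point is a deformation retraction of `X` onto `S`. -/
def DeformationRetractsAlongClosestPoint {E : Type*} [NormedAddCommGroup E] [NormedSpace ℝ E]
    (X S : Set E) : Prop :=
  (∀ x ∈ X, ∃! y, IsClosestPoint S x y) ∧
    IsDeformationRetraction X S
      (fun p : ℝ × E => (1 - p.1) • p.2 + p.1 • closestPointProj S p.2)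

/-- The discriminant `Δ`. -/
noncomputable def discr (R ε δ : ℝ) : ℝ :=
  1 / R ^ 2 * (ε ^ 2 - (R - δ) ^ 2) ^ 2 - 10 * (ε ^ 2 - (R - δ) ^ 2) - 7 * R ^ 2

/-- The number `α_min`. -/
noncomputable def alphaMin (R ε δ : ℝ) : ℝ :=
  1 / 4 * (((R - δ) ^ 2 + R ^ 2 - ε ^ 2) / R - Real.sqrt (discr R ε δ))

/-- The number `α_max`. -/
noncomputable def alphaMax (R ε δ : ℝ) : ℝ :=
  1 / 4 * (((R - δ) ^ 2 + R ^ 2 - ε ^ 2) / R + Real.sqrt (discr R ε δ))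

/-- The explicit range of radii. The condition `r < R` follows from the upper bound on `r ^ 2`
unless `ε = δ = 0`, where it excludes only the endpoint `r = R`. -/
def AdmissibleRadius (R ε δ r : ℝ) : Prop :=
  0 < r ∧ r < R ∧
    (1 + alphaMin R ε δ / R) * ε ^ 2 + alphaMin R ε δ ^ 2
        + alphaMin R ε δ / R * (R ^ 2 - (R - δ) ^ 2) ≤ r ^ 2 ∧
    r ^ 2 ≤ (R - δ) ^ 2 - (R - alphaMax R ε δ) ^ 2

/-! Let `y` be the closest point of `x`, `F` the distance from `x` to `y`, and `u` the unit vector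
from `y` to `x`. Both open balls of radius `R` tangent to `M` at `y`, centred at `y ± R u`, miss
`M`, so every point of `P` is at distance at least `R - δ` from both centres. Take `p₀ ∈ P` within
`r` of `x` and `p₁ ∈ P` within `ε` of `y`. Avoiding the ball at `y - R u` bounds the height of `p₁`
from below, so `p₁` covers the segment up to a height `α`. Avoiding the ball at `y + R u` shows that
`p₀` covers what lies above `α`. This is `covered_at_height`. A suitable `α` exists because the
lower bound minus the upper bound is a quadratic in `α`, nonpositive between `alphaMin` and
`alphaMax`.

The ball on the side of `x` misses `M` for any closed set of positive reach: the distance to `M` can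
be increased at unit speed away from `y` up to `R`. The opposite ball needs the manifold hypothesis
(a half-line violates it at its endpoint). If `q ∈ M` lay in that ball, push `M` by `t (q - y)` and
project back. By Brouwer, this small deformation still hits `y`, from some `p ∈ M` at distance
`O(t)` from `y`; the one-sided tangent-ball inequalities then fail to first order in `t`. -/

open Set Filter Topology MeasureTheory Metric

/-! ### Brouwer's theorem and small deformations of manifolds -/

/-- The determinant of `1 + t B` is interpolated from its values at `n + 1` nodes. -/
theorem det_one_add_smul_eq_sum_lagrange {E : Type*} [NormedAddCommGroup E] [NormedSpace ℝ E]
    [FiniteDimensional ℝ E] (c : ℕ → ℝ) (hc : Function.Injective c) (B : E →L[ℝ] E) (t : ℝ) :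
    (ContinuousLinearMap.id ℝ E + t • B).det =
      ∑ i ∈ Finset.range (Module.finrank ℝ E + 1),
        (Lagrange.basis (Finset.range (Module.finrank ℝ E + 1)) c i).eval t *
          (ContinuousLinearMap.id ℝ E + c i • B).det := by
  classical
  let b := Module.finBasis ℝ E
  let A := LinearMap.toMatrix b b (B : E →ₗ[ℝ] E)
  let p : Polynomial ℝ :=
    ((Polynomial.X : Polynomial ℝ) • A.map Polynomial.C + (1 : Matrix _ _ ℝ).map Polynomial.C).det
  have hp : ∀ s : ℝ, p.eval s = (ContinuousLinearMap.id ℝ E + s • B).det := by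
    intro s
    have h1 : (ContinuousLinearMap.id ℝ E + s • B).det
        = LinearMap.det ((LinearMap.id : E →ₗ[ℝ] E) + s • (B : E →ₗ[ℝ] E)) := rfl
    rw [h1, ← LinearMap.det_toMatrix b, map_add, map_smul, LinearMap.toMatrix_id]
    change Polynomial.evalRingHom s p = _
    rw [RingHom.map_det]
    congr 1
    ext i j
    simp [A, add_comm, Matrix.one_apply, apply_ite]
    exact mul_comm _ _
  have hdeg : p.degree < ((Finset.range (Module.finrank ℝ E + 1)).card : WithBot ℕ) := by
    refine lt_of_le_of_lt Polynomial.degree_le_natDegree ?_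
    have := Polynomial.natDegree_det_X_add_C_le A 1
    simp only [Fintype.card_fin] at this
    rw [Finset.card_range]
    exact_mod_cast Nat.lt_succ_of_le this
  have := Lagrange.eq_interpolate (f := p) (s := Finset.range (Module.finrank ℝ E + 1)) (v := c)
    hc.injOn hdeg
  rw [← hp t]
  conv_lhs => rw [this]
  rw [Lagrange.interpolate_apply, Polynomial.eval_finsetSum]
  refine Finset.sum_congr rfl fun i _ => ?_
  rw [Polynomial.eval_mul, Polynomial.eval_C, hp, mul_comm]

/-- Volume argument: extend `g - id` by zero outside the ball to `h`. For small `t`, `x + t h(x)` is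
a bijection fixing the exterior pointwise, so it preserves the ball and the Jacobian integrates to
its volume. The integral is polynomial in `t`, so this persists at `t = 1`, where the Jacobian is
that of `g` and vanishes. -/
theorem not_exists_contDiff_retraction {E : Type*} [NormedAddCommGroup E] [InnerProductSpace ℝ E]
    [FiniteDimensional ℝ E] (g : E → E) (hg : ContDiff ℝ 1 g)
    (hid : ∀ x, ‖x‖ = 1 → g x = x) (hsphere : ∀ x, ‖x‖ ≤ 1 → ‖g x‖ = 1) : False := by
  borelize E
  let D : Set E := closedBall 0 1
  have hD : ∀ x, x ∈ D ↔ ‖x‖ ≤ 1 := fun x => by simp [D]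
  have hDc : IsCompact D := isCompact_closedBall 0 1
  let B : E → E →L[ℝ] E := fun x => fderiv ℝ g x - ContinuousLinearMap.id ℝ E
  have hBcont : Continuous B := (hg.continuous_fderiv one_ne_zero).sub continuous_const
  have hgd : ∀ x, HasFDerivAt g (fderiv ℝ g x) x := fun x =>
    ((hg.differentiable one_ne_zero) x).hasFDerivAt
  have hkd : ∀ x, HasFDerivAt (fun x => g x - x) (B x) x := fun x => (hgd x).sub (hasFDerivAt_id x)
  let h : E → E := fun x => if ‖x‖ ≤ 1 then g x - x else 0
  have hin : ∀ x, ‖x‖ ≤ 1 → h x = g x - x := fun x hx => if_pos hx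
  have hout : ∀ x, ¬ ‖x‖ ≤ 1 → h x = 0 := fun x hx => if_neg hx
  -- `h` is Lipschitz
  obtain ⟨L, hL⟩ : ∃ L : NNReal, LipschitzWith L h := by
    obtain ⟨C, hC⟩ := hDc.exists_bound_of_continuousOn hBcont.continuousOn
    have hlipD : ∀ x ∈ D, ∀ y ∈ D, ‖(g x - x) - (g y - y)‖ ≤ C * ‖x - y‖ := fun x hx y hy =>
      (convex_closedBall (0 : E) 1).norm_image_sub_le_of_norm_hasFDerivWithin_le
        (fun z _ => (hkd z).hasFDerivWithinAt) hC hy hx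
    have hC0 : 0 ≤ C := (norm_nonneg _).trans (hC 0 (by simp [D]))
    -- A segment leaving the ball crosses the sphere, where `g z - z = 0`; compare with `x` there.
    have hmix : ∀ x y, ‖x‖ ≤ 1 → ¬ ‖y‖ ≤ 1 → ‖h x - h y‖ ≤ C * ‖x - y‖ := by
      intro x y hx hy
      have hcont : ContinuousOn (fun s : ℝ => ‖AffineMap.lineMap x y s‖) (Icc (0 : ℝ) 1) := by
        fun_prop
      have := intermediate_value_Icc (zero_le_one' ℝ) hcont
      obtain ⟨s, hs, hs1⟩ := this (show (1 : ℝ) ∈ _ by simp; exact ⟨hx, le_of_not_ge hy⟩)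
      set z := AffineMap.lineMap x y s with hz
      have hz1 : ‖z‖ = 1 := hs1
      have h0 : g z - z = 0 := by rw [hid z hz1, sub_self]
      have hxz : ‖x - z‖ ≤ ‖x - y‖ := by
        rw [← dist_eq_norm, ← dist_eq_norm, hz, dist_left_lineMap, Real.norm_of_nonneg hs.1]
        exact mul_le_of_le_one_left dist_nonneg hs.2
      have := hlipD x ((hD x).2 hx) z ((hD z).2 hz1.le)
      rw [h0, sub_zero] at this
      rw [hin x hx, hout y hy, sub_zero]
      exact this.trans (mul_le_mul_of_nonneg_left hxz hC0)
    refine ⟨C.toNNReal, LipschitzWith.of_dist_le_mul fun x y => ?_⟩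
    rw [Real.coe_toNNReal _ hC0, dist_eq_norm, dist_eq_norm]
    by_cases hx : ‖x‖ ≤ 1 <;> by_cases hy : ‖y‖ ≤ 1
    · rw [hin x hx, hin y hy]
      exact hlipD x ((hD x).2 hx) y ((hD y).2 hy)
    · exact hmix x y hx hy
    · rw [norm_sub_rev, norm_sub_rev x y]
      exact hmix y x hy hx
    · rw [hout x hx, hout y hy, sub_zero, norm_zero]; positivity
  let A : ℝ → E → E →L[ℝ] E := fun t x => ContinuousLinearMap.id ℝ E + t • B x
  have hAcont : Continuous fun p : ℝ × E => (A p.1 p.2).det := by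
    refine ContinuousLinearMap.continuous_det.comp ?_
    exact continuous_const.add (continuous_fst.smul (hBcont.comp continuous_snd))
  have hAint : ∀ t, Integrable (fun x => (A t x).det) (volume.restrict D) := fun t =>
    (hAcont.comp (Continuous.prodMk_right t)).continuousOn.integrableOn_compact hDc
  have hpos : ∀ᶠ t in 𝓝 (0 : ℝ), ∀ x ∈ D, 0 < (A t x).det := by
    refine hDc.eventually_forall_of_forall_eventually fun x _ => ?_
    refine hAcont.continuousAt.eventually (lt_mem_nhds ?_)
    simp [A, ContinuousLinearMap.det]
  have hbij : ∀ᶠ t in 𝓝 (0 : ℝ), Function.Bijective (fun x => x + t • h x) := by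
    have : ∀ᶠ t in 𝓝 (0 : ℝ), ‖t‖₊ * L < 1 := by
      have hc : Continuous fun t : ℝ => ‖t‖₊ * L := by fun_prop
      exact hc.continuousAt.eventually (gt_mem_nhds (by simp))
    filter_upwards [this] with t ht
    have hap : ApproximatesLinearOn (fun x => x + t • h x)
        ((ContinuousLinearEquiv.refl ℝ E : E ≃L[ℝ] E) : E →L[ℝ] E) univ (‖t‖₊ * L) := by
      intro x _ y _
      have : x + t • h x - (y + t • h y) - (x - y) = t • (h x - h y) := by
        rw [smul_sub]; abel
      simp only [ContinuousLinearEquiv.coe_refl, ContinuousLinearMap.id_apply] at *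
      rw [this, norm_smul]
      have h2 := hL.dist_le_mul x y
      rw [dist_eq_norm, dist_eq_norm] at h2
      push_cast
      rw [mul_assoc]
      exact mul_le_mul_of_nonneg_left h2 (norm_nonneg _)
    have hc : Subsingleton E ∨ ‖t‖₊ * L <
        ‖((ContinuousLinearEquiv.refl ℝ E).symm : E →L[ℝ] E)‖₊⁻¹ := by
      rcases subsingleton_or_nontrivial E with hs | hs
      · exact Or.inl hs
      · right
        have : ‖((ContinuousLinearEquiv.refl ℝ E).symm : E →L[ℝ] E)‖₊ = 1 := by
          have : ((ContinuousLinearEquiv.refl ℝ E).symm : E →L[ℝ] E) = ContinuousLinearMap.id ℝ E :=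
            rfl
          rw [this]
          exact NNReal.eq ContinuousLinearMap.norm_id
        rw [this, inv_one]; exact ht
    exact ⟨injOn_univ.1 (hap.injOn hc), hap.surjective hc⟩
  have hvol : ∀ᶠ t in 𝓝 (0 : ℝ), ∫ x in D, (A t x).det = volume.real D := by
    filter_upwards [hpos, hbij] with t htpos htbij
    have hfix : ∀ x, ¬ ‖x‖ ≤ 1 → x + t • h x = x := fun x hx => by rw [hout x hx]; simp
    have himage : (fun x => x + t • h x) '' D = D := by
      apply Subset.antisymm
      · rintro _ ⟨x, hx, rfl⟩
        by_contra hn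
        have h1 := hfix _ (fun hh => hn ((hD _).2 hh))
        have h2 : x + t • h x = x := htbij.1 h1
        exact hn (by simpa only [h2] using hx)
      · intro y hy
        obtain ⟨x, rfl⟩ := htbij.2 y
        by_cases hx : ‖x‖ ≤ 1
        · exact ⟨x, (hD x).2 hx, rfl⟩
        · simp only [hfix x hx] at hy ⊢
          exact absurd ((hD x).1 hy) hx
    have hder : ∀ x ∈ D, HasFDerivWithinAt (fun x => x + t • h x) (A t x) D x := by
      intro x hx
      have : HasFDerivWithinAt (fun x => x + t • (g x - x)) (A t x) D x :=
        ((hasFDerivAt_id x).add ((hkd x).const_smul t)).hasFDerivWithinAt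
      refine this.congr (fun z hz => ?_) ?_
      · rw [hin z ((hD z).1 hz)]
      · rw [hin x ((hD x).1 hx)]
    have hl := lintegral_abs_det_fderiv_eq_addHaar_image volume
      (isClosed_closedBall (x := (0 : E)) (ε := 1)).measurableSet hder htbij.1.injOn
    change ∫⁻ x in D, _ = volume ((fun x => x + t • h x) '' D) at hl
    rw [himage] at hl
    rw [integral_eq_lintegral_of_nonneg_ae _ (hAint t).1, Measure.real, ← hl]
    · congr 1
      refine setLIntegral_congr_fun isClosed_closedBall.measurableSet fun x hx => ?_
      simp only [abs_of_pos (htpos x hx)]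
    · exact (ae_restrict_iff' isClosed_closedBall.measurableSet).2
        (Eventually.of_forall fun x hx => (htpos x hx).le)
  obtain ⟨τ, hτ, hball⟩ := Metric.eventually_nhds_iff.1 hvol
  -- Distinct nodes in `(0, τ)`; the shift by `2` keeps the node `i = 0` strictly below `τ`.
  let c : ℕ → ℝ := fun i => τ / (i + 2)
  have hcinj : Function.Injective c := by
    intro i j hij
    simp only [c] at hij
    have hi : (i : ℝ) + 2 ≠ 0 := by positivity
    have hj : (j : ℝ) + 2 ≠ 0 := by positivity
    rw [div_eq_div_iff hi hj] at hij
    have := mul_left_cancel₀ hτ.ne' hij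
    exact_mod_cast (add_right_cancel this).symm
  have hcint : ∀ i, ∫ x in D, (A (c i) x).det = volume.real D := by
    intro i
    apply hball
    have h2 : (1 : ℝ) < i + 2 := by have : (0 : ℝ) ≤ i := i.cast_nonneg
                                    linarith
    rw [Real.dist_eq, sub_zero, abs_of_pos (by positivity)]
    exact div_lt_self hτ h2
  have hone : ∫ x in D, (A 1 x).det = volume.real D := by
    have h1 : ∀ x, (A 1 x).det = ∑ i ∈ Finset.range (Module.finrank ℝ E + 1),
        (Lagrange.basis (Finset.range (Module.finrank ℝ E + 1)) c i).eval 1 * (A (c i) x).det :=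
      fun x => det_one_add_smul_eq_sum_lagrange c hcinj (B x) 1
    simp_rw [h1]
    rw [integral_finsetSum _ fun i _ => (hAint (c i)).const_mul _]
    simp_rw [integral_const_mul, hcint]
    rw [← Finset.sum_mul, ← Polynomial.eval_finsetSum, Lagrange.sum_basis hcinj.injOn (by simp)]
    simp
  -- Differentiating `‖g‖² = 1` makes the range of the derivative orthogonal to `g x ≠ 0`, so it is
  -- not surjective.
  have hzero : ∀ x ∈ interior D, (A 1 x).det = 0 := by
    intro x hx
    have hA1 : A 1 x = fderiv ℝ g x := by simp [A, B]
    have hgx : ‖g x‖ = 1 := hsphere x ((hD x).1 (interior_subset hx))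
    have hloc : (fun z => inner ℝ (g z) (g z)) =ᶠ[𝓝 x] fun _ => (1 : ℝ) := by
      filter_upwards [mem_interior_iff_mem_nhds.1 hx] with z hz
      rw [real_inner_self_eq_norm_sq, hsphere z ((hD z).1 hz)]; norm_num
    have hd := ((hgd x).inner ℝ (hgd x)).congr_of_eventuallyEq hloc.symm
    have hd0 := hd.unique (hasFDerivAt_const (1 : ℝ) x)
    rw [hA1]
    by_contra hne
    have hs : Function.Surjective (fderiv ℝ g x : E →ₗ[ℝ] E) :=
      ((LinearMap.isUnit_iff_isUnit_det _).2 (Ne.isUnit hne) |>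
        (Module.End.isUnit_iff _).1).2
    obtain ⟨v, hv⟩ := hs (g x)
    have hv' : fderiv ℝ g x v = g x := hv
    have := congrArg (fun l : E →L[ℝ] ℝ => l v) hd0
    simp [fderivInnerCLM_apply, hv', hgx] at this
  have hint0 : ∫ x in D, (A 1 x).det = 0 := by
    have : interior D =ᵐ[volume] D :=
      interior_ae_eq_of_null_frontier ((convex_closedBall (0 : E) 1).addHaar_frontier volume)
    rw [← setIntegral_congr_set this]
    exact setIntegral_eq_zero_of_forall_eq_zero hzero
  have hvolpos : 0 < volume.real D :=
    ENNReal.toReal_pos (measure_closedBall_pos volume 0 one_pos).ne' hDc.measure_lt_top.ne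
  linarith

/-- A form of Brouwer's fixed point theorem. -/
theorem exists_eq_zero_of_norm_sub_lt_half {E : Type*} [NormedAddCommGroup E]
    [InnerProductSpace ℝ E] [FiniteDimensional ℝ E] (F : E → E)
    (hF : ContinuousOn F (closedBall 0 1)) (hclose : ∀ x, ‖x‖ ≤ 1 → ‖F x - x‖ < 1 / 2) :
    ∃ x, ‖x‖ ≤ 1 ∧ F x = 0 := by
  by_contra! hne
  -- The cutoff is `1` up to `1/2` and `0` from `3/4` on, so `G` joins `F` to the identity. In
  -- between, `‖x‖ > 1/2 > ‖F x - x‖` keeps `G` from vanishing.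
  let χ : ℝ → ℝ := fun s => max 0 (min 1 (3 - 4 * s))
  have hχc : Continuous χ := by fun_prop
  have hχ0 : ∀ s, 0 ≤ χ s := fun s => le_max_left _ _
  have hχ1 : ∀ s, χ s ≤ 1 := fun s => max_le zero_le_one (min_le_left _ _)
  have hχhalf : ∀ s, s ≤ 1 / 2 → χ s = 1 := fun s hs => by
    simp only [χ]; rw [min_eq_left (by linarith), max_eq_right zero_le_one]
  have hχout : ∀ s, 3 / 4 ≤ s → χ s = 0 := fun s hs => by
    simp only [χ]; exact max_eq_left ((min_le_right _ _).trans (by linarith))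
  let G : E → E := fun x => x + χ ‖x‖ • (F x - x)
  have hGid : ∀ x, 3 / 4 ≤ ‖x‖ → G x = x := fun x hx => by simp [G, hχout _ hx]
  have hGc : Continuous G := by
    refine continuous_iff_continuousAt.2 fun x => ?_
    rcases lt_or_ge ‖x‖ 1 with hx | hx
    · have : ContinuousAt F x := hF.continuousAt (closedBall_mem_nhds_of_mem (by simpa using hx))
      exact continuousAt_id.add
        ((hχc.continuousAt.comp continuous_norm.continuousAt).smul (this.sub continuousAt_id))
    · refine continuousAt_id.congr ?_
      have : ∀ᶠ z : E in 𝓝 x, 3 / 4 < ‖z‖ :=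
        continuous_norm.continuousAt.eventually (lt_mem_nhds (by linarith))
      filter_upwards [this] with z hz
      exact (hGid z hz.le).symm
  have hG0 : ∀ x, G x ≠ 0 := by
    intro x hx
    rcases le_or_gt ‖x‖ (1 / 2) with h | h
    · simp only [G, hχhalf _ h, one_smul, add_sub_cancel] at hx
      exact hne x (by linarith) hx
    · rcases le_or_gt (3 / 4) ‖x‖ with h' | h'
      · rw [hGid x h'] at hx
        rw [hx, norm_zero] at h; linarith
      · have h1 : ‖x‖ = χ ‖x‖ * ‖F x - x‖ := by
          have := congrArg norm (eq_neg_of_add_eq_zero_left hx)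
          rwa [norm_neg, norm_smul, Real.norm_of_nonneg (hχ0 ‖x‖)] at this
        have h2 := hclose x (by linarith)
        have := mul_le_of_le_one_left (norm_nonneg (F x - x)) (hχ1 ‖x‖)
        linarith
  have hU : IsOpen {x : E | 3 / 4 < ‖x‖} := isOpen_lt continuous_const continuous_norm
  -- The tolerance at `x` is `‖G x‖`, so the smooth `K` has no zero and can be normalised to a
  -- retraction onto the sphere.
  obtain ⟨K, hKs, hKclose, hKeq, -⟩ := hGc.exists_contDiff_approx_and_eqOn 1 hGc.norm
    (fun x => norm_pos_iff.2 (hG0 x)) (S := {x : E | 1 ≤ ‖x‖}) (U := {x : E | 3 / 4 < ‖x‖})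
    (isClosed_le continuous_const continuous_norm)
    (hU.mem_nhdsSet.2 fun x (hx : 1 ≤ ‖x‖) => show 3 / 4 < ‖x‖ by linarith)
    (contDiffOn_id.congr fun x (hx : 3 / 4 < ‖x‖) => hGid x hx.le)
  have hK0 : ∀ x, K x ≠ 0 := by
    intro x hx
    have := hKclose x
    rw [hx, dist_zero_left] at this
    exact lt_irrefl _ this
  refine not_exists_contDiff_retraction (fun x => ‖K x‖⁻¹ • K x)
    (((hKs.norm ℝ hK0).inv fun x => norm_ne_zero_iff.2 (hK0 x)).smul hKs) ?_ ?_
  · intro x hx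
    have : K x = x := (hKeq (show 1 ≤ ‖x‖ from hx.ge)).trans (hGid x (by linarith))
    simp [this, hx]
  · intro x _
    rw [norm_smul, norm_inv, norm_norm, inv_mul_cancel₀ (norm_ne_zero_iff.2 (hK0 x))]

/-- A small deformation of a manifold does not push the manifold off a point. -/
theorem eventually_exists_eq_of_deformation {X : Type*} [TopologicalSpace X] {n : ℕ}
    [ChartedSpace (EuclideanSpace ℝ (Fin n)) X] (H : ℝ → X → X) (τ : ℝ) (hτ : 0 < τ)
    (hH : ContinuousOn (Function.uncurry H) (Ioo (-τ) τ ×ˢ univ)) (hH0 : ∀ q, H 0 q = q)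
    (y : X) (W : Set X) (hW : W ∈ 𝓝 y) :
    ∀ᶠ t in 𝓝 (0 : ℝ), ∃ q ∈ W, H t q = y := by
  let φ := chartAt (EuclideanSpace ℝ (Fin n)) y
  have hy : y ∈ φ.source := mem_chart_source _ y
  have hopen : IsOpen (Ioo (-τ) τ ×ˢ (univ : Set X)) := isOpen_Ioo.prod isOpen_univ
  have hHat : ∀ t ∈ Ioo (-τ) τ, ∀ q, ContinuousAt (Function.uncurry H) (t, q) := fun t ht q =>
    hH.continuousAt (hopen.mem_nhds ⟨ht, mem_univ q⟩)
  have hN : φ.target ∩ φ.symm ⁻¹' W ∈ 𝓝 (φ y) := by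
    refine inter_mem (φ.open_target.mem_nhds (φ.map_source hy)) ?_
    refine (φ.continuousAt_symm (φ.map_source hy)).preimage_mem_nhds ?_
    rwa [φ.left_inv hy]
  obtain ⟨r, hr, hrN⟩ := nhds_basis_closedBall.mem_iff.1 hN
  let e : EuclideanSpace ℝ (Fin n) → EuclideanSpace ℝ (Fin n) := fun z => φ y + r • z
  have he : Continuous e := by fun_prop
  have hemem : ∀ z, ‖z‖ ≤ 1 → e z ∈ φ.target ∩ φ.symm ⁻¹' W := by
    intro z hz
    refine hrN ?_
    rw [mem_closedBall, dist_eq_norm, add_sub_cancel_left, norm_smul, Real.norm_of_nonneg hr.le]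
    exact mul_le_of_le_one_right hr.le hz
  have hsymm : ∀ z, ‖z‖ ≤ 1 → ContinuousAt (fun z => φ.symm (e z)) z := fun z hz =>
    (φ.continuousAt_symm (hemem z hz).1).comp he.continuousAt
  have hcomp : ∀ t ∈ Ioo (-τ) τ, ∀ z, ‖z‖ ≤ 1 →
      ContinuousAt (fun p : ℝ × EuclideanSpace ℝ (Fin n) => H p.1 (φ.symm (e p.2))) (t, z) := by
    intro t ht z hz
    have h1 : ContinuousAt (fun p : ℝ × EuclideanSpace ℝ (Fin n) => (p.1, φ.symm (e p.2)))
        (t, z) :=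
      continuousAt_fst.prodMk
        (ContinuousAt.comp (f := Prod.snd) (x := (t, z)) (hsymm z hz) continuousAt_snd)
    exact ContinuousAt.comp (g := Function.uncurry H)
      (f := fun p : ℝ × EuclideanSpace ℝ (Fin n) => (p.1, φ.symm (e p.2))) (x := (t, z))
      (hHat t ht _) h1
  have h0 : (0 : ℝ) ∈ Ioo (-τ) τ := ⟨by linarith, hτ⟩
  -- In a chart rescaled so that a small ball about `φ y` becomes the unit ball, `H t` is within
  -- `1/2` of the identity; a zero of this map is a preimage of `y`.
  have hev : ∀ᶠ t in 𝓝 (0 : ℝ), ∀ z ∈ closedBall (0 : EuclideanSpace ℝ (Fin n)) 1,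
      H t (φ.symm (e z)) ∈ φ.source ∧ ‖r⁻¹ • (φ (H t (φ.symm (e z))) - φ y) - z‖ < 1 / 2 := by
    refine (isCompact_closedBall _ _).eventually_forall_of_forall_eventually fun z hz => ?_
    rw [mem_closedBall_zero_iff] at hz
    have hval : H 0 (φ.symm (e z)) = φ.symm (e z) := hH0 _
    have hsrc : φ.symm (e z) ∈ φ.source := φ.map_target (hemem z hz).1
    have hc := hcomp 0 h0 z hz
    refine (hc.eventually_mem (φ.open_source.mem_nhds (by simpa only [hval] using hsrc))).and ?_
    have hφ : ContinuousAt φ (H 0 (φ.symm (e z))) := by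
      rw [hval]; exact φ.continuousAt hsrc
    have hc2 : ContinuousAt (fun p : ℝ × EuclideanSpace ℝ (Fin n) =>
        ‖r⁻¹ • (φ (H p.1 (φ.symm (e p.2))) - φ y) - p.2‖) (0, z) := by
      have : ContinuousAt (fun p : ℝ × EuclideanSpace ℝ (Fin n) =>
        φ (H p.1 (φ.symm (e p.2)))) (0, z) := ContinuousAt.comp (g := φ) hφ hc
      exact (((this.sub continuousAt_const).const_smul r⁻¹).sub continuousAt_snd).norm
    refine hc2.eventually (gt_mem_nhds ?_)
    simp only [hval, φ.right_inv (hemem z hz).1, e, add_sub_cancel_left, inv_smul_smul₀ hr.ne',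
      sub_self, norm_zero]
    norm_num
  filter_upwards [hev, isOpen_Ioo.mem_nhds h0] with t ht htτ
  obtain ⟨z, hz, hz0⟩ := exists_eq_zero_of_norm_sub_lt_half
    (fun z => r⁻¹ • (φ (H t (φ.symm (e z))) - φ y)) (by
      intro z hz
      have hz' := mem_closedBall_zero_iff.1 hz
      have h1 : ContinuousAt (fun z => H t (φ.symm (e z))) z :=
        ContinuousAt.comp (g := fun p : ℝ × EuclideanSpace ℝ (Fin n) => H p.1 (φ.symm (e p.2)))
          (f := fun z => (t, z)) (hcomp t htτ z hz') (by fun_prop)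
      have h2 : ContinuousAt (fun z => φ (H t (φ.symm (e z)))) z :=
        ContinuousAt.comp (g := φ) (φ.continuousAt (ht z hz).1) h1
      exact ((h2.sub continuousAt_const).const_smul r⁻¹).continuousWithinAt)
    (fun z hz => (ht z (mem_closedBall_zero_iff.2 hz)).2)
  refine ⟨φ.symm (e z), (hemem z hz).2, φ.injOn (ht z (mem_closedBall_zero_iff.2 hz)).1 hy ?_⟩
  exact sub_eq_zero.1 ((smul_eq_zero.1 hz0).resolve_left (inv_ne_zero hr.ne'))

/-! ### Closest points and the reach -/

theorem IsClosestPoint.closestPointProj {E : Type*} [PseudoMetricSpace E] {S : Set E} {x y : E}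
    (h : IsClosestPoint S x y) : IsClosestPoint S x (closestPointProj S x) := by
  have hex : ∃ y, IsClosestPoint S x y := ⟨y, h⟩
  rw [_root_.closestPointProj, dif_pos hex]
  exact hex.choose_spec

theorem isClosestPoint_closestPointProj {E : Type*} [PseudoMetricSpace E] [ProperSpace E]
    {S : Set E} (hS : IsClosed S) (hne : S.Nonempty) (x : E) :
    IsClosestPoint S x (closestPointProj S x) := by
  obtain ⟨y, hy, hxy⟩ := hS.exists_infDist_eq_dist hne x
  exact IsClosestPoint.closestPointProj ⟨hy, hxy.symm⟩

theorem closestPointProj_of_mem {E : Type*} [MetricSpace E] {S : Set E} {x : E} (hx : x ∈ S) :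
    closestPointProj S x = x := by
  have h0 : infDist x S = 0 := infDist_zero_of_mem hx
  have h : IsClosestPoint S x x := ⟨hx, by rw [h0, dist_self]⟩
  have h2 := h.closestPointProj.2
  rw [h0] at h2
  exact (dist_eq_zero.1 h2).symm

theorem existsUnique_isClosestPoint_of_infDist_lt {E : Type*} [PseudoMetricSpace E] {S : Set E}
    {R : ℝ} (hne : S.Nonempty) (hR : ENNReal.ofReal R ≤ reach S) {x : E}
    (hx : infDist x S < R) : ∃! y, IsClosestPoint S x y := by
  by_contra hmem
  have h1 : reach S ≤ infEDist x S := iInf₂_le x hmem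
  have h2 := ENNReal.ofReal_le_iff_le_toReal (infEDist_ne_top hne) |>.1 (hR.trans h1)
  exact absurd hx (not_lt.2 h2)

/-! ### Continuity of the projection and tangent balls -/

section Projection

variable {E : Type*} [NormedAddCommGroup E] [InnerProductSpace ℝ E] [FiniteDimensional ℝ E]
  {M : Set E} {R : ℝ}

/-- Projections of nearby points stay in a compact ball, and each of their cluster points is a
closest point of `x`; uniqueness leaves only one. -/
theorem continuousAt_closestPointProj (hM : IsClosed M) (hne : M.Nonempty) {x : E}
    (hx : ∃! y, IsClosestPoint M x y) : ContinuousAt (closestPointProj M) x := by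
  have hspec := isClosestPoint_closestPointProj hM hne
  refine (isCompact_closedBall x (infDist x M + 2)).tendsto_nhds_of_unique_mapClusterPt ?_ ?_
  · filter_upwards [ball_mem_nhds x one_pos] with z hz
    have h1 := (hspec z).2
    have h2 := infDist_le_infDist_add_dist (s := M) (x := z) (y := x)
    have h3 := dist_triangle (closestPointProj M z) z x
    rw [dist_comm _ z] at h3
    rw [mem_ball] at hz
    rw [mem_closedBall]; linarith
  · intro w _ hw
    refine hx.unique ⟨?_, ?_⟩ (hspec x)
    · refine isClosed_iff_clusterPt.1 hM w ?_
      exact ClusterPt.mono (mapClusterPt_def.1 hw)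
        (le_principal_iff.2 (mem_map.2 (univ_mem' fun z => (hspec z).1)))
    · refine le_antisymm (le_of_forall_pos_le_add fun ε hε => ?_) ?_
      · have h1 := hw.frequently (ball_mem_nhds w (show 0 < ε / 3 by positivity))
        obtain ⟨z, hz1, hz2⟩ :=
          (h1.and_eventually (ball_mem_nhds x (show 0 < ε / 3 by positivity))).exists
        have hz1 : dist (closestPointProj M z) w < ε / 3 := hz1
        have hz2 : dist z x < ε / 3 := hz2
        have h3 := (hspec z).2
        have h4 := infDist_le_infDist_add_dist (s := M) (x := z) (y := x)
        have h5 := dist_triangle4 x z (closestPointProj M z) w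
        rw [dist_comm x z] at h5
        linarith
      · refine infDist_le_dist_of_mem (isClosed_iff_clusterPt.1 hM w ?_)
        exact ClusterPt.mono (mapClusterPt_def.1 hw)
          (le_principal_iff.2 (mem_map.2 (univ_mem' fun z => (hspec z).1)))

/-- Moving away from the closest point, the distance grows at unit speed. -/
theorem eventually_lt_infDist_add_smul (hM : IsClosed M) (hne : M.Nonempty) {x : E}
    (hx : ∃! y, IsClosestPoint M x y) (hpos : 0 < infDist x M) {η : ℝ} (hη : 0 < η)
    (hη1 : η < 1) :
    ∀ᶠ h in 𝓝[>] (0 : ℝ), infDist x M + (1 - η) * h <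
      infDist (x + h • (‖x - closestPointProj M x‖⁻¹ • (x - closestPointProj M x))) M := by
  have hspec := isClosestPoint_closestPointProj hM hne
  set y := closestPointProj M x with hy
  have hnorm : ‖x - y‖ = infDist x M := by rw [← dist_eq_norm]; exact (hspec x).2
  set F := infDist x M with hF
  set ν := ‖x - y‖⁻¹ • (x - y) with hν
  have hν1 : ‖ν‖ = 1 := by
    rw [hν, norm_smul, norm_inv, norm_norm, hnorm, inv_mul_cancel₀ hpos.ne']
  have hinner : inner ℝ ν (x - y) = F := by
    rw [hν, inner_smul_left, real_inner_self_eq_norm_sq, hnorm]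
    simp only [conj_trivial]; field_simp
  -- At `h = 0` this equals `2 η F > 0`. Positivity for small `h` contradicts growth slower than `1
  -- - η`, after expanding the squared distance.
  have hcont : ContinuousAt (fun h : ℝ => 2 * inner ℝ ν (x - closestPointProj M (x + h • ν))
      - (1 - η) * (2 * F + h)) 0 := by
    have h1 : ContinuousAt (fun h : ℝ => closestPointProj M (x + h • ν)) 0 :=
      ContinuousAt.comp (g := closestPointProj M) (f := fun h : ℝ => x + h • ν)
        (by simpa using continuousAt_closestPointProj hM hne hx) (by fun_prop)
    fun_prop
  have hev := hcont.eventually (lt_mem_nhds (a := 0) (by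
    simp only [zero_smul, add_zero, ← hy, hinner]; nlinarith))
  filter_upwards [nhdsWithin_le_nhds hev, self_mem_nhdsWithin] with h hh (hh0 : 0 < h)
  set w := closestPointProj M (x + h • ν) with hw
  have e1 : ‖x + h • ν - w‖ = infDist (x + h • ν) M := by
    rw [← dist_eq_norm]; exact (hspec _).2
  have e2 : F ≤ ‖x - w‖ := by
    rw [← dist_eq_norm]; exact infDist_le_dist_of_mem (hspec _).1
  have e3 : ‖x + h • ν - w‖ ^ 2 = ‖x - w‖ ^ 2 + 2 * h * inner ℝ ν (x - w) + h ^ 2 := by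
    have : x + h • ν - w = (x - w) + h • ν := by abel
    rw [this, norm_add_sq_real, norm_smul, hν1, inner_smul_right, real_inner_comm,
      Real.norm_of_nonneg hh0.le]
    ring
  rw [e1] at e3
  set F1 := infDist (x + h • ν) M
  by_contra! hcon
  have hF1 : 0 ≤ F1 := infDist_nonneg
  have e4 : F1 ^ 2 ≥ F ^ 2 + 2 * h * inner ℝ ν (x - w) := by nlinarith
  have e5 : F1 + F ≤ 2 * F + h := by nlinarith
  have e6 : (F1 - F) * (F1 + F) ≤ (1 - η) * h * (F1 + F) :=
    mul_le_mul_of_nonneg_right (by linarith) (by linarith)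
  have e7 : (1 - η) * h * (F1 + F) ≤ (1 - η) * h * (2 * F + h) :=
    mul_le_mul_of_nonneg_left e5 (mul_nonneg (by linarith) hh0.le)
  nlinarith

/-- Maximise the distance to `M` minus `1 - η` times the distance to `x` over a closed ball. Growth
at almost unit speed forces the maximiser onto the sphere; then `η` tends to `0`. -/
theorem exists_dist_eq_infDist_eq_add (hM : IsClosed M) (hne : M.Nonempty)
    (hU : ∀ x, infDist x M < R → ∃! y, IsClosestPoint M x y) {x : E} (hpos : 0 < infDist x M)
    {ρ : ℝ} (hρ : 0 < ρ) (hlt : infDist x M + ρ < R) :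
    ∃ z, dist z x = ρ ∧ infDist z M = infDist x M + ρ := by
  have hle : ∀ z, infDist z M ≤ infDist x M + dist z x := fun z => infDist_le_infDist_add_dist
  have key : ∀ η : ℝ, 0 < η → η < 1 →
      ∃ z, dist z x = ρ ∧ infDist x M + (1 - η) * ρ ≤ infDist z M := by
    intro η hη hη1
    obtain ⟨z, hz, hmax⟩ := (isCompact_closedBall x ρ).exists_isMaxOn
      ⟨x, mem_closedBall_self hρ.le⟩
      (f := fun z => infDist z M - (1 - η) * dist z x)
      ((continuous_infDist_pt M).sub (continuous_const.mul
        (continuous_id.dist continuous_const))).continuousOn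
    have hzx := hmax (mem_closedBall_self hρ.le)
    simp only [mem_ofPred_eq, dist_self, mul_zero, sub_zero] at hzx
    rw [mem_closedBall] at hz
    have hd0 : 0 ≤ (1 - η) * dist z x := mul_nonneg (by linarith) dist_nonneg
    rcases hz.lt_or_eq with hlt' | heq
    · exfalso
      have hzU := hU z (by linarith [hle z])
      have hev := eventually_lt_infDist_add_smul hM hne hzU (by linarith) hη hη1
      set ν := ‖z - closestPointProj M z‖⁻¹ • (z - closestPointProj M z)
      have hν : ‖ν‖ ≤ 1 := by
        rw [norm_smul, norm_inv, norm_norm]; exact inv_mul_le_one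
      have hsmall : ∀ᶠ h in 𝓝[>] (0 : ℝ), h < ρ - dist z x :=
        nhdsWithin_le_nhds (gt_mem_nhds (by linarith))
      obtain ⟨h, ⟨h1, h2⟩, h3⟩ := ((hev.and hsmall).and self_mem_nhdsWithin).exists
      have h3 : 0 < h := h3
      have h4 : dist (z + h • ν) x ≤ dist z x + h := by
        have := dist_triangle (z + h • ν) z x
        rw [dist_self_add_left, norm_smul, Real.norm_of_nonneg h3.le] at this
        nlinarith
      have h5 := hmax (mem_closedBall.2 (show dist (z + h • ν) x ≤ ρ by linarith))
      simp only [mem_ofPred_eq] at h5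
      have : (1 - η) * dist (z + h • ν) x ≤ (1 - η) * (dist z x + h) :=
        mul_le_mul_of_nonneg_left h4 (by linarith)
      linarith
    · exact ⟨z, heq, by rw [heq] at hzx; linarith⟩
  obtain ⟨z0, hz0, -⟩ := key (1 / 2) (by norm_num) (by norm_num)
  obtain ⟨z, hz, hmax⟩ := (isCompact_sphere x ρ).exists_isMaxOn ⟨z0, hz0⟩
    (continuous_infDist_pt M).continuousOn
  have hz : dist z x = ρ := hz
  refine ⟨z, hz, le_antisymm (hz ▸ hle z) (le_of_forall_pos_sub_le fun ε hε => ?_)⟩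
  obtain ⟨z1, hz1, hz2⟩ := key (min (1 / 2) (ε / ρ)) (by positivity)
    (lt_of_le_of_lt (min_le_left _ _) (by norm_num))
  have h1 : infDist z1 M ≤ infDist z M := hmax hz1
  have h2 : min (1 / 2) (ε / ρ) * ρ ≤ ε := by
    calc min (1 / 2) (ε / ρ) * ρ ≤ ε / ρ * ρ := mul_le_mul_of_nonneg_right (min_le_right _ _) hρ.le
      _ = ε := div_mul_cancel₀ _ hρ.ne'
  linarith

/-- The open ball of radius `R` tangent to `M` at the closest point of `x` on the side of `x`
does not meet `M`. -/
theorem two_mul_inner_le_of_closestPointProj (hM : IsClosed M) (hne : M.Nonempty)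
    (hU : ∀ x, infDist x M < R → ∃! y, IsClosestPoint M x y) {x : E} (hx : infDist x M < R)
    {q : E} (hq : q ∈ M) :
    2 * R * inner ℝ (q - closestPointProj M x) (x - closestPointProj M x) ≤
      ‖x - closestPointProj M x‖ * ‖q - closestPointProj M x‖ ^ 2 := by
  have hspec := isClosestPoint_closestPointProj hM hne x
  set y := closestPointProj M x
  have hF : ‖x - y‖ = infDist x M := by rw [← dist_eq_norm]; exact hspec.2
  rcases (infDist_nonneg (x := x) (s := M)).eq_or_lt with h0 | hpos
  · have : x - y = 0 := by rw [← norm_eq_zero, hF, ← h0]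
    simp [this]
  have key : ∀ t, infDist x M < t → t < R →
      2 * t * inner ℝ (q - y) (x - y) ≤ ‖x - y‖ * ‖q - y‖ ^ 2 := by
    intro t ht htR
    obtain ⟨z, hz, hzM⟩ := exists_dist_eq_infDist_eq_add hM hne hU hpos (sub_pos.2 ht)
      (by linarith)
    rw [dist_eq_norm] at hz
    rw [add_sub_cancel] at hzM
    rw [← hF] at ht hz hpos
    set F := ‖x - y‖
    have hzy : t ≤ ‖z - y‖ := by
      rw [← hzM, ← dist_eq_norm]; exact infDist_le_dist_of_mem hspec.1
    have hzq : t ≤ ‖z - q‖ := by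
      rw [← hzM, ← dist_eq_norm]; exact infDist_le_dist_of_mem hq
    have e1 : ‖z - y‖ ^ 2 = (t - F) ^ 2 + 2 * inner ℝ (z - x) (x - y) + F ^ 2 := by
      rw [← sub_add_sub_cancel z x y, norm_add_sq_real, hz]
    have e2 : (t - F) * F ≤ inner ℝ (z - x) (x - y) := by nlinarith
    -- Equality in Cauchy–Schwarz: `z` lies on the ray from `y` through `x`, at distance `t` from
    -- `y`.
    have e3 : F • (z - x) = (t - F) • (x - y) := by
      rw [← sub_eq_zero, ← norm_eq_zero, ← sq_eq_zero_iff]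
      refine le_antisymm ?_ (sq_nonneg _)
      rw [norm_sub_sq_real, norm_smul, norm_smul, inner_smul_left, inner_smul_right, hz,
        Real.norm_of_nonneg hpos.le, Real.norm_of_nonneg (sub_pos.2 ht).le]
      simp only [conj_trivial]
      have : 0 ≤ F * (t - F) * (inner ℝ (z - x) (x - y) - (t - F) * F) :=
        mul_nonneg (mul_nonneg hpos.le (sub_pos.2 ht).le) (by linarith)
      change (F * (t - F)) ^ 2 - 2 * (F * ((t - F) * inner ℝ (z - x) (x - y)))
        + ((t - F) * F) ^ 2 ≤ 0
      nlinarith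
    have e4 : F • (z - q) = t • (x - y) - F • (q - y) := by
      have : F • (z - q) = F • (z - x) + F • (x - y) - F • (q - y) := by module
      rw [this, e3]; module
    have e5 := congrArg (fun v => ‖v‖ ^ 2) e4
    simp only [norm_sub_sq_real (t • (x - y)), norm_smul, inner_smul_left, inner_smul_right,
      conj_trivial, mul_pow, Real.norm_eq_abs, sq_abs] at e5
    rw [real_inner_comm] at e5
    change F ^ 2 * ‖z - q‖ ^ 2 = t ^ 2 * F ^ 2 - _ + _ at e5
    have e6 : t ^ 2 ≤ ‖z - q‖ ^ 2 := pow_le_pow_left₀ (by linarith) hzq 2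
    have e7 : F * (2 * t * inner ℝ (q - y) (x - y)) ≤ F * (F * ‖q - y‖ ^ 2) := by nlinarith
    exact le_of_mul_le_mul_left e7 hpos
  have hlim : Tendsto (fun t : ℝ => 2 * t * inner ℝ (q - y) (x - y)) (𝓝[<] R)
      (𝓝 (2 * R * inner ℝ (q - y) (x - y))) :=
    (Continuous.tendsto (by fun_prop) R).mono_left nhdsWithin_le_nhds
  refine le_of_tendsto hlim ?_
  filter_upwards [nhdsWithin_le_nhds (lt_mem_nhds hx), self_mem_nhdsWithin] with t h1 h2
  exact key t h1 h2

/-- The open ball of radius `R` tangent to the manifold `M` at the closest point of `x` on the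
side opposite to `x` does not meet `M`. -/
theorem neg_two_mul_inner_le_of_closestPointProj {n : ℕ} (hM : IsClosed M)
    (hsub : IsSubmanifold n M) (hR : 0 < R)
    (hU : ∀ x, infDist x M < R → ∃! y, IsClosestPoint M x y) {x : E} (hx : infDist x M < R)
    {q : E} (hq : q ∈ M) :
    -(2 * R * inner ℝ (q - closestPointProj M x) (x - closestPointProj M x)) ≤
      ‖x - closestPointProj M x‖ * ‖q - closestPointProj M x‖ ^ 2 := by
  have hne : M.Nonempty := ⟨q, hq⟩
  have hspec := isClosestPoint_closestPointProj hM hne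
  have hyM := (hspec x).1
  have hball : ∀ p ∈ M, 2 * R * inner ℝ (p - closestPointProj M x) (x - closestPointProj M x) ≤
      ‖x - closestPointProj M x‖ * ‖p - closestPointProj M x‖ ^ 2 := fun p hp =>
    two_mul_inner_le_of_closestPointProj hM hne hU hx hp
  set y := closestPointProj M x
  by_contra! hcon
  have hxy : 0 < ‖x - y‖ := by
    rw [norm_pos_iff]; intro h0
    simp [h0] at hcon
  set w := q - y with hw
  obtain ⟨hcharted⟩ := hsub
  -- Translate `M` towards `q` and project back.
  let H : ℝ → M → M := fun t p => ⟨closestPointProj M (p + t • w), (hspec _).1⟩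
  have hH0 : ∀ p, H 0 p = p := fun p => Subtype.ext (by
    simp only [H, zero_smul, add_zero]
    exact closestPointProj_of_mem p.2)
  have hτ : 0 < R / (‖w‖ + 1) := by positivity
  have hH : ContinuousOn (Function.uncurry H)
      (Ioo (-(R / (‖w‖ + 1))) (R / (‖w‖ + 1)) ×ˢ univ) := by
    rw [Topology.IsInducing.subtypeVal.continuousOn_iff]
    rintro ⟨t, p⟩ ⟨ht, -⟩
    refine ContinuousAt.continuousWithinAt ?_
    refine ContinuousAt.comp (g := closestPointProj M) (f := fun z : ℝ × M => (z.2 : E) + z.1 • w)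
      (continuousAt_closestPointProj hM hne (hU _ ?_)) (by fun_prop)
    have h1 : infDist ((p : E) + t • w) M ≤ ‖t‖ * ‖w‖ := by
      have := infDist_le_dist_of_mem (x := (p : E) + t • w) p.2
      rwa [dist_self_add_left, norm_smul] at this
    have h2 : ‖t‖ < R / (‖w‖ + 1) := abs_lt.2 ht
    rw [lt_div_iff₀ (by positivity)] at h2
    nlinarith [norm_nonneg t]
  have hW : {p : M | ‖(p : E) - y‖ < R} ∈ 𝓝 (⟨y, hyM⟩ : M) := by
    refine (isOpen_lt (by fun_prop) continuous_const).mem_nhds ?_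
    simpa using hR
  have hev := eventually_exists_eq_of_deformation (n := n) H _ hτ hH hH0 ⟨y, hyM⟩ _ hW
  set W := ‖w‖ with hWdef
  set F := ‖x - y‖
  set c := -(2 * R * inner ℝ w (x - y)) - F * W ^ 2 with hc
  have hc0 : 0 < c := sub_pos.2 hcon
  set C := (W ^ 2 + 2 * R * W) / R with hC
  have hCR : C * R = W ^ 2 + 2 * R * W := div_mul_cancel₀ _ hR.ne'
  have hsmall : ∀ᶠ t in 𝓝 (0 : ℝ), 2 * F * C ^ 2 * t < c ∧ t < R / (W + 1) := by
    refine Eventually.and ?_ (gt_mem_nhds hτ)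
    have : ContinuousAt (fun t : ℝ => 2 * F * C ^ 2 * t) 0 := by fun_prop
    exact this.eventually (gt_mem_nhds (by simpa using hc0))
  obtain ⟨t, ⟨⟨p, hpW, hpt⟩, ht1, ht2⟩, ht0⟩ :=
    (((hev.and hsmall).filter_mono nhdsWithin_le_nhds).and
      (self_mem_nhdsWithin (s := Ioi (0 : ℝ)))).exists
  have ht0 : 0 < t := ht0
  have hpW : ‖(p : E) - y‖ < R := hpW
  have hpt : closestPointProj M ((p : E) + t • w) = y := congrArg Subtype.val hpt
  have hlt : infDist ((p : E) + t • w) M < R := by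
    have := infDist_le_dist_of_mem (x := (p : E) + t • w) p.2
    rw [dist_self_add_left, norm_smul, Real.norm_of_nonneg ht0.le] at this
    rw [lt_div_iff₀ (by positivity)] at ht2
    nlinarith
  have i1 := two_mul_inner_le_of_closestPointProj hM hne hU hlt p.2
  have i2 := two_mul_inner_le_of_closestPointProj hM hne hU hlt hq
  have i3 := hball p p.2
  rw [hpt] at i1 i2
  have hv : (p : E) + t • w - y = ((p : E) - y) + t • w := by abel
  rw [hv] at i1 i2
  set a := (p : E) - y
  set v := a + t • w with hvdef
  have hvv : ‖v‖ ^ 2 = inner ℝ a v + t * inner ℝ w v := by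
    rw [← real_inner_self_eq_norm_sq]
    conv_lhs => rw [hvdef, inner_add_left, inner_smul_left, ← hvdef]
    simp
  change 2 * R * inner ℝ w v ≤ ‖v‖ * W ^ 2 at i2
  -- The point `y + v` projects to `y`, so its tangent ball excludes both `p` and `q`; add the two
  -- inequalities with weights `1` and `t`.
  have j1 : 2 * R * ‖v‖ ≤ ‖a‖ ^ 2 + t * W ^ 2 := by
    rcases (norm_nonneg v).eq_or_lt with h0 | h0
    · rw [← h0]; nlinarith [sq_nonneg ‖a‖, sq_nonneg W]
    · refine le_of_mul_le_mul_left ?_ h0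
      nlinarith [mul_le_mul_of_nonneg_left i2 ht0.le]
  have j2 : -(inner ℝ a (x - y) + t * inner ℝ w (x - y)) ≤ ‖v‖ * F := by
    have := neg_le_of_abs_le (abs_real_inner_le_norm v (x - y))
    have e : inner ℝ v (x - y) = inner ℝ a (x - y) + t * inner ℝ w (x - y) := by
      rw [hvdef, inner_add_left, inner_smul_left]; simp
    rw [e] at this; linarith
  have j3 : ‖a‖ ≤ ‖v‖ + t * W := by
    have : a = v - t • w := by rw [hvdef]; abel
    calc ‖a‖ = ‖v - t • w‖ := by rw [← this]
      _ ≤ ‖v‖ + ‖t • w‖ := norm_sub_le _ _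
      _ = _ := by rw [norm_smul, Real.norm_of_nonneg ht0.le]
  -- The left side is linear in `t`, while `j5` makes the right side quadratic.
  have j4 : t * c ≤ 2 * F * ‖a‖ ^ 2 := by
    have k1 := mul_le_mul_of_nonneg_left j1 hxy.le
    have k2 := mul_le_mul_of_nonneg_left j2 hR.le
    rw [hc]; nlinarith
  -- Since `‖a‖ < R`, the quadratic term of `j1` is absorbed into the left side.
  have j5 : ‖a‖ ≤ t * C := by
    have k1 : ‖a‖ * ‖a‖ ≤ R * ‖a‖ := mul_le_mul_of_nonneg_right hpW.le (norm_nonneg a)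
    refine le_of_mul_le_mul_right ?_ hR
    nlinarith [mul_le_mul_of_nonneg_left j3 hR.le]
  have j6 : ‖a‖ ^ 2 ≤ (t * C) ^ 2 := pow_le_pow_left₀ (norm_nonneg a) j5 2
  have j7 : t * c ≤ t * (2 * F * C ^ 2 * t) := by
    have := mul_le_mul_of_nonneg_left j6 (show 0 ≤ 2 * F by positivity)
    nlinarith
  have := le_of_mul_le_mul_left j7 ht0
  linarith

end Projection

/-! ### Arithmetic of the admissible radii -/

section Radii

variable {R ε δ : ℝ}

/-- Completing the square explains the constant `4√2 - 5`: with `K = (R - δ)² - ε² ≥ 0`, `Δ ≥ 0`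
means `K + 5R² ≥ 4√2 R²`. -/
theorem sq_mul_discr (hR : 0 < R) : R ^ 2 * discr R ε δ =
    ((R - δ) ^ 2 - ε ^ 2 + 5 * R ^ 2) ^ 2 - 32 * R ^ 4 := by
  unfold discr; field_simp; ring

theorem discr_nonneg (hR : 0 < R)
    (hbound : (4 * Real.sqrt 2 - 5) * R ^ 2 ≤ (R - δ) ^ 2 - ε ^ 2) : 0 ≤ discr R ε δ := by
  have h2 : Real.sqrt 2 ^ 2 = 2 := Real.sq_sqrt (by norm_num)
  have h : (4 * Real.sqrt 2 * R ^ 2) ^ 2 ≤ ((R - δ) ^ 2 - ε ^ 2 + 5 * R ^ 2) ^ 2 :=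
    pow_le_pow_left₀ (by positivity) (by linarith) 2
  have h3 : (4 * Real.sqrt 2 * R ^ 2) ^ 2 = 32 * R ^ 4 := by
    rw [mul_pow, mul_pow, h2]; ring
  refine nonneg_of_mul_nonneg_right ?_ (show 0 < R ^ 2 by positivity)
  rw [sq_mul_discr hR]; linarith

theorem alphaMin_le_alphaMax : alphaMin R ε δ ≤ alphaMax R ε δ := by
  unfold alphaMin alphaMax
  linarith [Real.sqrt_nonneg (discr R ε δ)]

theorem sq_sub_sq_le (hδ0 : 0 ≤ δ) (hδR : δ < R) : (R - δ) ^ 2 - ε ^ 2 ≤ R ^ 2 := by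
  nlinarith [sq_nonneg ε]

/-- After isolating the square root and squaring, this and the bound `alphaMax ≤ R` both reduce to
`K ≤ R²`, where `K = (R - δ)² - ε²`. -/
theorem alphaMin_nonneg (hR : 0 < R) (hδ0 : 0 ≤ δ) (hδR : δ < R)
    (hbound : (4 * Real.sqrt 2 - 5) * R ^ 2 ≤ (R - δ) ^ 2 - ε ^ 2) : 0 ≤ alphaMin R ε δ := by
  have hK := sq_sub_sq_le (ε := ε) hδ0 hδR
  have h2 : (5 : ℝ) / 4 ≤ Real.sqrt 2 := Real.le_sqrt_of_sq_le (by norm_num)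
  have hK0 : 0 ≤ (R - δ) ^ 2 - ε ^ 2 :=
    (mul_nonneg (by linarith) (sq_nonneg R)).trans hbound
  have hs : Real.sqrt (discr R ε δ) ≤ ((R - δ) ^ 2 + R ^ 2 - ε ^ 2) / R := by
    rw [le_div_iff₀ hR]
    refine abs_le_of_sq_le_sq' ?_ (by nlinarith [sq_nonneg R]) |>.2
    rw [mul_pow, Real.sq_sqrt (discr_nonneg hR hbound), mul_comm, sq_mul_discr hR]
    nlinarith [mul_nonneg (sub_nonneg.2 hK) (sq_nonneg R)]
  unfold alphaMin; linarith

theorem alphaMax_le (hR : 0 < R) (hδ0 : 0 ≤ δ) (hδR : δ < R)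
    (hbound : (4 * Real.sqrt 2 - 5) * R ^ 2 ≤ (R - δ) ^ 2 - ε ^ 2) : alphaMax R ε δ ≤ R := by
  have hK := sq_sub_sq_le (ε := ε) hδ0 hδR
  have hs : Real.sqrt (discr R ε δ) * R ≤ 3 * R ^ 2 - ((R - δ) ^ 2 - ε ^ 2) := by
    refine abs_le_of_sq_le_sq' ?_ (by nlinarith [sq_nonneg R]) |>.2
    rw [mul_pow, Real.sq_sqrt (discr_nonneg hR hbound), mul_comm, sq_mul_discr hR]
    nlinarith [mul_nonneg (sub_nonneg.2 hK) (sq_nonneg R)]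
  unfold alphaMax
  have : ((R - δ) ^ 2 + R ^ 2 - ε ^ 2) / R * R = (R - δ) ^ 2 + R ^ 2 - ε ^ 2 :=
    div_mul_cancel₀ _ hR.ne'
  nlinarith

theorem alphaMax_lt (hR : 0 < R) (hδ0 : 0 ≤ δ) (hδR : δ < R) (hε : 0 < ε)
    (hbound : (4 * Real.sqrt 2 - 5) * R ^ 2 ≤ (R - δ) ^ 2 - ε ^ 2) : alphaMax R ε δ < R := by
  have hK : (R - δ) ^ 2 - ε ^ 2 < R ^ 2 := by nlinarith [pow_pos hε 2]
  have hs : Real.sqrt (discr R ε δ) * R < 3 * R ^ 2 - ((R - δ) ^ 2 - ε ^ 2) := by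
    refine abs_lt_of_sq_lt_sq' ?_ (by nlinarith [sq_nonneg R]) |>.2
    rw [mul_pow, Real.sq_sqrt (discr_nonneg hR hbound), mul_comm, sq_mul_discr hR]
    nlinarith [mul_pos (sub_pos.2 hK) (pow_pos hR 2)]
  unfold alphaMax
  have : ((R - δ) ^ 2 + R ^ 2 - ε ^ 2) / R * R = (R - δ) ^ 2 + R ^ 2 - ε ^ 2 :=
    div_mul_cancel₀ _ hR.ne'
  nlinarith

/-- The numbers `α_min` and `α_max` are the roots of the difference of the two bounds. -/
theorem lower_sub_upper_eq (hR : 0 < R)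
    (hbound : (4 * Real.sqrt 2 - 5) * R ^ 2 ≤ (R - δ) ^ 2 - ε ^ 2) (α : ℝ) :
    (1 + α / R) * ε ^ 2 + α ^ 2 + α / R * (R ^ 2 - (R - δ) ^ 2) -
      ((R - δ) ^ 2 - (R - α) ^ 2) = 2 * ((α - alphaMin R ε δ) * (α - alphaMax R ε δ)) := by
  have hs : Real.sqrt (discr R ε δ) ^ 2 = discr R ε δ := Real.sq_sqrt (discr_nonneg hR hbound)
  have h1 : (α - alphaMin R ε δ) * (α - alphaMax R ε δ) =
      (α - ((R - δ) ^ 2 + R ^ 2 - ε ^ 2) / R / 4) ^ 2 - Real.sqrt (discr R ε δ) ^ 2 / 16 := by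
    unfold alphaMin alphaMax; ring
  rw [h1, hs, discr]
  field_simp
  ring

theorem exists_admissibleRadius (hR : 0 < R) (hδ0 : 0 ≤ δ) (hδε : δ ≤ ε) (hεR : ε < R)
    (hbound : (4 * Real.sqrt 2 - 5) * R ^ 2 ≤ (R - δ) ^ 2 - ε ^ 2) :
    ∃ r, AdmissibleRadius R ε δ r := by
  have hδR : δ < R := by linarith
  have hmin := alphaMin_nonneg hR hδ0 hδR hbound
  have hle := alphaMin_le_alphaMax (R := R) (ε := ε) (δ := δ)
  have hmax := alphaMax_le hR hδ0 hδR hbound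
  have e1 := lower_sub_upper_eq hR hbound (alphaMin R ε δ)
  have e2 := lower_sub_upper_eq hR hbound (alphaMax R ε δ)
  simp only [sub_self, zero_mul, mul_zero] at e1 e2
  have hupper : (R - alphaMax R ε δ) ^ 2 ≤ (R - alphaMin R ε δ) ^ 2 :=
    pow_le_pow_left₀ (by linarith) (by linarith) 2
  -- If `ε = δ = 0`, the upper endpoint is the excluded `r = R`, so `R / 2` is used; otherwise the
  -- upper endpoint itself works.
  rcases (hδ0.trans hδε).eq_or_lt with h0 | hε
  · obtain rfl : ε = 0 := h0.symm
    obtain rfl : δ = 0 := le_antisymm hδε hδ0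
    have hd : discr R 0 0 = (2 * R) ^ 2 := by
      unfold discr; field_simp; ring
    have hA : alphaMin R 0 0 = 0 := by
      unfold alphaMin; rw [hd, Real.sqrt_sq (by linarith)]; field_simp; ring
    have hB : alphaMax R 0 0 = R := by
      unfold alphaMax; rw [hd, Real.sqrt_sq (by linarith)]; field_simp; ring
    refine ⟨R / 2, by linarith, by linarith, ?_, ?_⟩
    · rw [hA]; simp; positivity
    · rw [hB]; nlinarith
  · have hlt := alphaMax_lt hR hδ0 hδR hε hbound
    have hpos : 0 < (R - δ) ^ 2 - (R - alphaMax R ε δ) ^ 2 := by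
      have h1 : 0 ≤ alphaMax R ε δ / R := div_nonneg (hmin.trans hle) hR.le
      have h2 : 0 ≤ R ^ 2 - (R - δ) ^ 2 := by nlinarith
      have := mul_nonneg h1 h2
      have := mul_nonneg h1 (sq_nonneg ε)
      nlinarith [sq_nonneg (alphaMax R ε δ), pow_pos hε 2]
    refine ⟨Real.sqrt ((R - δ) ^ 2 - (R - alphaMax R ε δ) ^ 2), Real.sqrt_pos.2 hpos, ?_, ?_, ?_⟩
    · rw [Real.sqrt_lt' hR]
      nlinarith [pow_pos (sub_pos.2 hlt) 2]
    · rw [Real.sq_sqrt hpos.le]; linarith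
    · rw [Real.sq_sqrt hpos.le]

/-- The lower bound, as a function of `α`, is at most `r²` at `alphaMin` and, agreeing with the
upper bound, at least `r²` at `alphaMax`. Take `α` where it equals `r²`; between the roots it does
not exceed the upper bound. -/
theorem AdmissibleRadius.exists_height {r : ℝ} (h : AdmissibleRadius R ε δ r) (hR : 0 < R)
    (hbound : (4 * Real.sqrt 2 - 5) * R ^ 2 ≤ (R - δ) ^ 2 - ε ^ 2) :
    ∃ α : ℝ, (1 + α / R) * ε ^ 2 + α ^ 2 + α / R * (R ^ 2 - (R - δ) ^ 2) ≤ r ^ 2 ∧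
      r ^ 2 ≤ (R - δ) ^ 2 - (R - α) ^ 2 := by
  obtain ⟨-, -, hl, hu⟩ := h
  have e2 := lower_sub_upper_eq hR hbound (alphaMax R ε δ)
  simp only [sub_self, mul_zero] at e2
  have hcont : ContinuousOn
      (fun α : ℝ => (1 + α / R) * ε ^ 2 + α ^ 2 + α / R * (R ^ 2 - (R - δ) ^ 2))
      (Icc (alphaMin R ε δ) (alphaMax R ε δ)) := by fun_prop
  obtain ⟨α, ⟨h1, h2⟩, hα⟩ := intermediate_value_Icc alphaMin_le_alphaMax hcont
    (show r ^ 2 ∈ _ from ⟨hl, by linarith⟩)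
  refine ⟨α, hα.le, ?_⟩
  have e := lower_sub_upper_eq hR hbound α
  have := mul_nonpos_of_nonneg_of_nonpos (sub_nonneg.2 h1) (sub_nonpos.2 h2)
  simp only at hα
  linarith

/-- This keeps `P ⊕ B(r)` within distance less than `R` of `M`, where closest points are unique. -/
theorem AdmissibleRadius.add_lt {r : ℝ} (h : AdmissibleRadius R ε δ r) (hR : 0 < R)
    (hδ0 : 0 ≤ δ) (hδε : δ ≤ ε) (hεR : ε < R)
    (hbound : (4 * Real.sqrt 2 - 5) * R ^ 2 ≤ (R - δ) ^ 2 - ε ^ 2) : r + δ < R := by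
  obtain ⟨hr, hrR, -, hu⟩ := h
  rcases (hδ0.trans hδε).eq_or_lt with h0 | hε
  · linarith
  · have hlt := alphaMax_lt hR hδ0 (by linarith) hε hbound
    have : r ^ 2 < (R - δ) ^ 2 := by nlinarith [pow_pos (sub_pos.2 hlt) 2]
    linarith [lt_of_pow_lt_pow_left₀ 2 (by linarith) this]

theorem AdmissibleRadius.le {r : ℝ} (h : AdmissibleRadius R ε δ r) (hR : 0 < R)
    (hδ0 : 0 ≤ δ) (hδR : δ < R)
    (hbound : (4 * Real.sqrt 2 - 5) * R ^ 2 ≤ (R - δ) ^ 2 - ε ^ 2) : ε ≤ r := by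
  obtain ⟨hr, -, hl, -⟩ := h
  have h1 : 0 ≤ alphaMin R ε δ / R := div_nonneg (alphaMin_nonneg hR hδ0 hδR hbound) hR.le
  have h2 : 0 ≤ R ^ 2 - (R - δ) ^ 2 := by nlinarith
  refine abs_le_of_sq_le_sq' ?_ hr.le |>.2
  nlinarith [mul_nonneg h1 h2, mul_nonneg h1 (sq_nonneg ε), sq_nonneg (alphaMin R ε δ)]

/-- In a plane section through the normal direction: a point at height `s` is covered by one of
two balls of radius `r`, whose centres have squared norms `N₀`, `N₁` and heights `a₀`, `a₁`. -/
theorem covered_at_height {r α s F N₀ a₀ N₁ a₁ : ℝ} (hR : 0 < R) (hδ0 : 0 ≤ δ) (hδR : δ < R)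
    (hl : (1 + α / R) * ε ^ 2 + α ^ 2 + α / R * (R ^ 2 - (R - δ) ^ 2) ≤ r ^ 2)
    (hu : r ^ 2 ≤ (R - δ) ^ 2 - (R - α) ^ 2) (hs0 : 0 ≤ s) (hsF : s ≤ F) (hFR : F < R)
    (h0 : N₀ - 2 * F * a₀ + F ^ 2 ≤ r ^ 2) (h0R : (R - δ) ^ 2 ≤ N₀ - 2 * R * a₀ + R ^ 2)
    (h1 : N₁ ≤ ε ^ 2) (h1R : (R - δ) ^ 2 ≤ N₁ + 2 * R * a₁ + R ^ 2) :
    N₀ - 2 * s * a₀ + s ^ 2 ≤ r ^ 2 ∨ N₁ - 2 * s * a₁ + s ^ 2 ≤ r ^ 2 := by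
  rcases le_or_gt s α with hsα | hsα
  · right
    refine le_trans ?_ hl
    have h2 : 0 ≤ R ^ 2 - (R - δ) ^ 2 := by nlinarith
    have h3 : s / R ≤ α / R := div_le_div_of_nonneg_right hsα hR.le
    have h4 : 0 ≤ s / R := div_nonneg hs0 hR.le
    have h5 : s / R * R = s := div_mul_cancel₀ _ hR.ne'
    -- The ball at height `-R` limits how far the second centre can lie below the tangent plane.
    have h6 : -(2 * s * a₁) ≤ s / R * (R ^ 2 + ε ^ 2 - (R - δ) ^ 2) := by
      have : s / R * (-(2 * R * a₁)) ≤ s / R * (R ^ 2 + ε ^ 2 - (R - δ) ^ 2) :=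
        mul_le_mul_of_nonneg_left (by linarith) h4
      calc -(2 * s * a₁) = s / R * (-(2 * R * a₁)) := by rw [← h5]; field_simp
        _ ≤ _ := this
    have h7 : s / R * (R ^ 2 + ε ^ 2 - (R - δ) ^ 2) ≤ α / R * (R ^ 2 + ε ^ 2 - (R - δ) ^ 2) :=
      mul_le_mul_of_nonneg_right h3 (by nlinarith [sq_nonneg ε])
    have h8 : s ^ 2 ≤ α ^ 2 := pow_le_pow_left₀ hs0 hsα 2
    nlinarith
  · left
    -- If the first ball misses height `s` but contains height `F`, the squared distance to its
    -- centre is below `r² + (R - α)² ≤ (R - δ)²` at height `R`, contradicting `h0R`.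
    by_contra! hcon
    have h2 : (F - s) * (F + s - 2 * a₀) < 0 := by nlinarith
    have h3 : F + s - 2 * a₀ < 0 := by
      by_contra! h; nlinarith [mul_nonneg (sub_nonneg.2 hsF) h]
    have h4 : (R - F) * (R + F - 2 * a₀) < (R - F) * (R - s) :=
      mul_lt_mul_of_pos_left (by linarith) (by linarith)
    have h5 : (R - F) * (R - s) ≤ (R - s) * (R - s) :=
      mul_le_mul_of_nonneg_right (by linarith) (by linarith)
    have h6 : (R - s) * (R - s) ≤ (R - α) * (R - α) :=
      mul_self_le_mul_self (by linarith) (by linarith)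
    nlinarith

end Radii

/-! ### Covering the segments and the deformation retraction -/

theorem mem_add_closedBall_zero_iff {E : Type*} [SeminormedAddCommGroup E] {P : Set E} {r : ℝ}
    {x : E} : x ∈ P + closedBall (0 : E) r ↔ ∃ p ∈ P, ‖p - x‖ ≤ r := by
  constructor
  · rintro ⟨p, hp, v, hv, rfl⟩
    exact ⟨p, hp, by simpa using hv⟩
  · rintro ⟨p, hp, h⟩
    exact ⟨p, hp, x - p, by rwa [mem_closedBall_zero_iff, norm_sub_rev], by simp⟩

theorem norm_sub_add_smul_sq {E : Type*} [NormedAddCommGroup E] [InnerProductSpace ℝ E]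
    {u : E} (hu : ‖u‖ = 1) (p y : E) (s : ℝ) :
    ‖p - (y + s • u)‖ ^ 2 = ‖p - y‖ ^ 2 - 2 * s * inner ℝ (p - y) u + s ^ 2 := by
  rw [← sub_sub, norm_sub_sq_real, inner_smul_right, norm_smul, hu, mul_one, Real.norm_eq_abs,
    sq_abs]
  ring

/-- If `c` is at distance at least `R` from `M`, it is at distance at least `R - δ` from any
point that is `δ`-close to `M`. -/
theorem sub_sq_le_norm_sub_sq {E : Type*} [SeminormedAddCommGroup E] {M : Set E}
    {R δ : ℝ} {c p : E} (hδR : δ < R) (hc : ∀ q ∈ M, R ^ 2 ≤ ‖q - c‖ ^ 2)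
    (hp : p ∈ M + closedBall (0 : E) δ) : (R - δ) ^ 2 ≤ ‖p - c‖ ^ 2 := by
  obtain ⟨q, hq, hqp⟩ := mem_add_closedBall_zero_iff.1 hp
  have h1 : R ≤ ‖q - c‖ := abs_le_of_sq_le_sq' (hc q hq) (norm_nonneg _) |>.2
  have h2 := norm_sub_le_norm_sub_add_norm_sub q p c
  exact pow_le_pow_left₀ (by linarith) (by linarith) 2

section Retraction

variable {E : Type*} [NormedAddCommGroup E] [InnerProductSpace ℝ E] [FiniteDimensional ℝ E]
  {M P : Set E} {R ε δ : ℝ} {n : ℕ}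

theorem segment_mem_add_closedBall (hM : IsClosed M) (hsub : IsSubmanifold n M) (hR : 0 < R)
    (hreach : ENNReal.ofReal R ≤ reach M) (hε : M ⊆ P + closedBall (0 : E) ε)
    (hδ : P ⊆ M + closedBall (0 : E) δ) (hδ0 : 0 ≤ δ) (hδR : δ < R)
    {r α : ℝ} (hr : 0 < r)
    (hl : (1 + α / R) * ε ^ 2 + α ^ 2 + α / R * (R ^ 2 - (R - δ) ^ 2) ≤ r ^ 2)
    (hu : r ^ 2 ≤ (R - δ) ^ 2 - (R - α) ^ 2) (hne : M.Nonempty) {x : E}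
    (hxR : infDist x M < R) (hx : x ∈ P + closedBall (0 : E) r) {t : ℝ} (ht : t ∈ Icc (0 : ℝ) 1) :
    (1 - t) • x + t • closestPointProj M x ∈ P + closedBall (0 : E) r := by
  have hU : ∀ x, infDist x M < R → ∃! y, IsClosestPoint M x y := fun x hx =>
    existsUnique_isClosestPoint_of_infDist_lt hne hreach hx
  have hspec := isClosestPoint_closestPointProj hM hne x
  have hin := fun q (hq : q ∈ M) => two_mul_inner_le_of_closestPointProj hM hne hU hxR hq
  have hout := fun q (hq : q ∈ M) => neg_two_mul_inner_le_of_closestPointProj hM hsub hR hU hxR hq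
  set y := closestPointProj M x
  have hF : ‖x - y‖ = infDist x M := by rw [← dist_eq_norm]; exact hspec.2
  rw [← hF] at hxR
  rcases (norm_nonneg (x - y)).eq_or_lt with h0 | hpos
  · have hxy : x = y := sub_eq_zero.1 (norm_eq_zero.1 h0.symm)
    have : (1 - t) • x + t • y = x := by rw [← hxy]; module
    rwa [this]
  set F := ‖x - y‖
  set u := F⁻¹ • (x - y) with hudef
  have hu1 : ‖u‖ = 1 := by
    rw [hudef, norm_smul, norm_inv, Real.norm_of_nonneg hpos.le]
    exact inv_mul_cancel₀ hpos.ne'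
  have hFu : F • u = x - y := smul_inv_smul₀ hpos.ne' _
  -- The two inner-product inequalities, divided by `F`, say that `q` lies outside both tangent
  -- balls.
  have hball : ∀ q ∈ M, R ^ 2 ≤ ‖q - (y + R • u)‖ ^ 2 ∧ R ^ 2 ≤ ‖q - (y + (-R) • u)‖ ^ 2 := by
    intro q hq
    rw [norm_sub_add_smul_sq hu1, norm_sub_add_smul_sq hu1]
    have h1 := hin q hq
    have h2 := hout q hq
    rw [← hFu, inner_smul_right] at h1 h2
    have h3 : 2 * R * inner ℝ (q - y) u ≤ ‖q - y‖ ^ 2 := by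
      refine le_of_mul_le_mul_left ?_ hpos
      linarith
    have h4 : -(2 * R * inner ℝ (q - y) u) ≤ ‖q - y‖ ^ 2 := by
      refine le_of_mul_le_mul_left ?_ hpos
      linarith
    constructor <;> linarith
  obtain ⟨p₀, hp₀, hp₀x⟩ := mem_add_closedBall_zero_iff.1 hx
  obtain ⟨p₁, hp₁, hp₁y⟩ := mem_add_closedBall_zero_iff.1 (hε hspec.1)
  have hxu : x = y + F • u := by rw [hFu]; abel
  have a0 : ‖p₀ - x‖ ^ 2 ≤ r ^ 2 := pow_le_pow_left₀ (norm_nonneg _) hp₀x 2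
  rw [hxu, norm_sub_add_smul_sq hu1] at a0
  have a1 := sub_sq_le_norm_sub_sq hδR (fun q hq => (hball q hq).1) (hδ hp₀)
  have a2 := sub_sq_le_norm_sub_sq hδR (fun q hq => (hball q hq).2) (hδ hp₁)
  rw [norm_sub_add_smul_sq hu1] at a1 a2
  have hpt : (1 - t) • x + t • y = y + ((1 - t) * F) • u := by
    rw [mul_smul, hFu]; module
  rw [hpt, mem_add_closedBall_zero_iff]
  rcases covered_at_height hR hδ0 hδR hl hu
    (mul_nonneg (sub_nonneg.2 ht.2) hpos.le : 0 ≤ (1 - t) * F)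
    (mul_le_of_le_one_left hpos.le (by linarith [ht.1])) hxR a0 a1
    (pow_le_pow_left₀ (norm_nonneg _) hp₁y 2) (a₁ := inner ℝ (p₁ - y) u) (by linarith) with h | h
  · refine ⟨p₀, hp₀, abs_le_of_sq_le_sq' ?_ hr.le |>.2⟩
    rwa [norm_sub_add_smul_sq hu1]
  · refine ⟨p₁, hp₁, abs_le_of_sq_le_sq' ?_ hr.le |>.2⟩
    rwa [norm_sub_add_smul_sq hu1]

theorem AdmissibleRadius.deformationRetracts (hM : IsClosed M) (hsub : IsSubmanifold n M)
    (hR : 0 < R) (hreach : ENNReal.ofReal R ≤ reach M) (hε : M ⊆ P + closedBall (0 : E) ε)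
    (hδ : P ⊆ M + closedBall (0 : E) δ) (hδ0 : 0 ≤ δ) (hδε : δ ≤ ε) (hεR : ε < R)
    (hbound : (4 * Real.sqrt 2 - 5) * R ^ 2 ≤ (R - δ) ^ 2 - ε ^ 2) {r : ℝ}
    (h : AdmissibleRadius R ε δ r) :
    DeformationRetractsAlongClosestPoint (P + closedBall (0 : E) r) M := by
  have hδR : δ < R := by linarith
  obtain ⟨α, hl, hu⟩ := h.exists_height hR hbound
  -- `M` may be empty, and `infDist` to the empty set is `0`, so nonemptiness is drawn from the
  -- given `x`.
  have hnear : ∀ x ∈ P + closedBall (0 : E) r, M.Nonempty ∧ infDist x M < R := by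
    intro x hx
    obtain ⟨p, hp, hpx⟩ := mem_add_closedBall_zero_iff.1 hx
    obtain ⟨q, hq, hqp⟩ := mem_add_closedBall_zero_iff.1 (hδ hp)
    refine ⟨⟨q, hq⟩, ?_⟩
    have h1 : infDist x M ≤ ‖q - x‖ := by
      rw [norm_sub_rev, ← dist_eq_norm]; exact infDist_le_dist_of_mem hq
    have h2 := norm_sub_le_norm_sub_add_norm_sub q p x
    linarith [h.add_lt hR hδ0 hδε hεR hbound]
  have hunique : ∀ x ∈ P + closedBall (0 : E) r, ∃! y, IsClosestPoint M x y := fun x hx =>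
    existsUnique_isClosestPoint_of_infDist_lt (hnear x hx).1 hreach (hnear x hx).2
  refine ⟨hunique, ?_, ?_, ?_, ?_, ?_, ?_⟩
  · intro y hy
    obtain ⟨p, hp, hpy⟩ := mem_add_closedBall_zero_iff.1 (hε hy)
    exact mem_add_closedBall_zero_iff.2 ⟨p, hp, hpy.trans (h.le hR hδ0 hδR hbound)⟩
  · rintro ⟨t, x⟩ ⟨-, hx⟩
    have hπ : ContinuousAt (fun p : ℝ × E => closestPointProj M p.2) (t, x) :=
      ContinuousAt.comp (g := closestPointProj M) (f := Prod.snd)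
        (continuousAt_closestPointProj hM (hnear x hx).1 (hunique x hx)) continuousAt_snd
    exact (((continuousAt_const.sub continuousAt_fst).smul continuousAt_snd).add
      (continuousAt_fst.smul hπ)).continuousWithinAt
  · intro t ht x hx
    exact segment_mem_add_closedBall hM hsub hR hreach hε hδ hδ0 hδR h.1 hl hu
      (hnear x hx).1 (hnear x hx).2 hx ht
  · intro x _
    simp
  · intro x hx
    simpa using (isClosestPoint_closestPointProj hM (hnear x hx).1 x).1
  · intro t _ a ha
    change (1 - t) • a + t • closestPointProj M a = a
    rw [closestPointProj_of_mem ha]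
    module

end Retraction

theorem proposition3p5 (d n : ℕ) (M P : Set (EuclideanSpace ℝ (Fin d))) (R ε δ : ℝ)
    (hMclosed : IsClosed M) (hM : IsSubmanifold n M)
    (hR : 0 < R) (hreach : ENNReal.ofReal R ≤ reach M)
    (hε : M ⊆ P + Metric.closedBall (0 : EuclideanSpace ℝ (Fin d)) ε)
    (hδ : P ⊆ M + Metric.closedBall (0 : EuclideanSpace ℝ (Fin d)) δ)
    (hδ0 : 0 ≤ δ) (hδε : δ ≤ ε) (hεR : ε < R)
    (hbound : (4 * Real.sqrt 2 - 5) * R ^ 2 ≤ (R - δ) ^ 2 - ε ^ 2) :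
    (∃ r : ℝ, AdmissibleRadius R ε δ r ∧
      DeformationRetractsAlongClosestPoint
        (P + Metric.closedBall (0 : EuclideanSpace ℝ (Fin d)) r) M) ∧
    ∀ r : ℝ, AdmissibleRadius R ε δ r →
      DeformationRetractsAlongClosestPoint
        (P + Metric.closedBall (0 : EuclideanSpace ℝ (Fin d)) r) M := by
  have hall : ∀ r : ℝ, AdmissibleRadius R ε δ r →
      DeformationRetractsAlongClosestPoint
        (P + Metric.closedBall (0 : EuclideanSpace ℝ (Fin d)) r) M := fun r hr =>
    hr.deformationRetracts hMclosed hM hR hreach hε hδ hδ0 hδε hεR hbound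
  obtain ⟨r, hr⟩ := exists_admissibleRadius hR hδ0 hδε hεR hbound
  exact ⟨⟨r, hr, hall r hr⟩, hall⟩
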